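/- All graphs are finite, simple and undirected. For a graph $G=(V,E)$ and $S\subseteq V$, the power domination process first observes the closed neighbourhood $N[S]$; then, as long as some observed vertex has exactly one unobserved neighbour, that neighbour becomes observed. $S$ is a power dominating set if every vertex of $G$ is eventually observed. For an integer $k\ge 0$, a multiset $S$ of vertices of $G$ is a $k$-PMU-defect-robust power dominating set if $|S|\ge k$ and, for every submultiset $F\subseteq S$ with $|F|=k$, the multiset $S\setminus F$ contains a power dominating set of vertices. Let $\ddot\gamma_P^k(G)$ be the minimum cardinality (counted with multiplicity) of such a multiset. Let $\mathcal T$ be the family of graphs obtained, up to isomorphism, from a connected graph $H$ by adding, for each vertex $v\in V(H)$, two new vertices $v',v''$ and the two edges $vv',vv''$, where for each $v$ the edge $v'v''$ may or may not be added as well. Let $G$ be a connected graph with $n\ge 3$ vertices. Then \[\ddot\gamma_P^k(G)\le (k+1)\frac n3\qquad\text{for every integer } k\ge 0.\] For $k=0$, equality holds if and only if $G\in\mathcal T$ or $G$ is isomorphic to the complete bipartite graph $K_{3,3}$. For each $k\ge 1$, equality holds if and only if $G\in\mathcal T$. -/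

import Mathlib

universe u

namespace PMU

/-- The vertices observed by the power domination process started from the PMU locations `S`:
the closed neighbourhood of `S` is observed, and an observed vertex `v` all of whose neighbours
other than `w` are observed makes its neighbour `w` observed. -/
inductive Observed {V : Type u} (G : SimpleGraph V) (S : Set V) : V → Prop
  | self (v : V) : v ∈ S → Observed G S v
  | neighbor (v w : V) : v ∈ S → G.Adj v w → Observed G S w
  | force (v w : V) : Observed G S v → G.Adj v w →
      (∀ x, G.Adj v x → x ≠ w → Observed G S x) → Observed G S w

/-- `S` is a power dominating set of `G`. -/
def IsPowerDominating {V : Type u} (G : SimpleGraph V) (S : Set V) : Prop :=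
  ∀ v, Observed G S v

/-- The multiset `S` of PMU locations is a `k`-PMU-defect-robust power dominating set:
it has at least `k` elements, so that `k` of them can fail, and whichever `k` of them fail,
the remaining ones contain a power dominating set of vertices. -/
def IsRobustPowerDominating {V : Type u} [DecidableEq V] (G : SimpleGraph V) (k : ℕ)
    (S : Multiset V) : Prop :=
  k ≤ S.card ∧ ∀ F : Multiset V, F ≤ S → F.card = k →
    ∃ D : Finset V, D.val ≤ S - F ∧ IsPowerDominating G (D : Set V)

/-- The `k`-PMU-defect-robust power domination number: the minimum cardinality, counted with
multiplicity, of a `k`-PMU-defect-robust power dominating set. -/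
noncomputable def robustPowerDominationNumber {V : Type u} [DecidableEq V]
    (G : SimpleGraph V) (k : ℕ) : ℕ :=
  sInf {m : ℕ | ∃ S : Multiset V, IsRobustPowerDominating G k S ∧ S.card = m}

/-- On a finite nonempty vertex set the minimum is over a nonempty set, hence attained. -/
theorem exists_isRobustPowerDominating {V : Type u} [Fintype V] [Nonempty V] [DecidableEq V]
    (G : SimpleGraph V) (k : ℕ) : ∃ S : Multiset V, IsRobustPowerDominating G k S := by
  refine ⟨(k + 1) • (Finset.univ : Finset V).val, ?_, fun F _ hk => ⟨Finset.univ, ?_, ?_⟩⟩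
  · have : 0 < Fintype.card V := Fintype.card_pos
    simp only [Multiset.card_nsmul, Finset.card_val, Finset.card_univ, smul_eq_mul]
    nlinarith
  · rw [Multiset.le_iff_count]
    intro v
    have h1 := Multiset.count_le_card v F
    have h2 : Multiset.count v (Finset.univ : Finset V).val = 1 :=
      Multiset.count_eq_one_of_mem Finset.univ.nodup (Finset.mem_univ v)
    rw [Multiset.count_sub, Multiset.count_nsmul, h2]
    omega
  · intro v
    exact Observed.self v (by simp)

/-- The graph obtained from `H` by attaching to each vertex `v = (v, 0)` of `H` two new vertices
`v' = (v, 1)` and `v'' = (v, 2)` with the edges `vv'` and `vv''`, and adding the optional edge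
`v'v''` exactly for the vertices `v ∈ A`. -/
def attachPairs {W : Type u} (H : SimpleGraph W) (A : Set W) : SimpleGraph (W × Fin 3) :=
  SimpleGraph.fromRel fun p q =>
    (p.2 = 0 ∧ q.2 = 0 ∧ H.Adj p.1 q.1) ∨
    (p.1 = q.1 ∧ p.2 = 0 ∧ q.2 = 1) ∨
    (p.1 = q.1 ∧ p.2 = 0 ∧ q.2 = 2) ∨
    (p.1 = q.1 ∧ p.2 = 1 ∧ q.2 = 2 ∧ p.1 ∈ A)

/-- Membership, up to isomorphism, in the family `𝒯` of all graphs `attachPairs H A` with `H`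
a connected graph. -/
def InFamilyT {V : Type u} (G : SimpleGraph V) : Prop :=
  ∃ (W : Type u) (H : SimpleGraph W) (A : Set W),
    H.Connected ∧ Nonempty (G ≃g attachPairs H A)

/-- `G` is the complete bipartite graph `K₃,₃`, up to isomorphism. -/
def IsK33 {V : Type u} (G : SimpleGraph V) : Prop :=
  Nonempty (G ≃g completeBipartiteGraph (Fin 3) (Fin 3))

end PMU

namespace PMU

open Finset

/-! ### Propagation of observation and its obstruction by twins -/

section Observation

variable {V : Type u} {G : SimpleGraph V}

/-! The upper bound comes from a power dominating set `S` with `3|S| ≤ n`, each vertex taken `k + 1`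
times. Let `S` have minimum cardinality, then induce as many edges as possible, then contain as many
vertices of degree at least two as possible. If `v ∈ S` had at most one external private neighbour,
`v` could be moved to any neighbour `u`: `u` observes `v`, and `v` then forces its private
neighbour. Minimality excludes neighbours of `v` in `S`; edge maximality excludes non-private
neighbours outside `S`; so `v` is a leaf, and moving it to its neighbour contradicts the last
choice. Hence every vertex of `S` has two private neighbours, and the resulting triples are disjoint
(`exists_isDensePD_two_le`, `three_mul_card_le`).

If `3|S| = n`, the triples partition the graph (`IsTightPD`). With no edge between private
neighbours of different vertices, `G` lies in `𝒯`. Such an edge, between private neighbours of `v`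
and `u`, makes `vu` an isolated edge of `G[S]` by exchange; minimality turns private neighbours into
twins, and connectedness leaves only `K₃,₃`.

Conversely, in `𝒯` the two added vertices of a triple are twins, never observed from outside their
triple, so each triple needs `k + 1` PMUs. In `K₃,₃` two PMUs are needed for `k = 0`, but for `k ≥
1` the multiplicities `k, k, 1` on one side beat `2(k + 1)`. -/

theorem Observed.trans {S T : Set V} (h1 : ∀ v ∈ S, Observed G T v)
    (h2 : ∀ v ∈ S, ∀ w, G.Adj v w → Observed G T w) {v : V} (h : Observed G S v) :
    Observed G T v := by
  induction h with
  | self v hv => exact h1 v hv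
  | neighbor v w hv hw => exact h2 v hv w hw
  | force v w _ hvw _ ih1 ih2 => exact Observed.force v w ih1 hvw ih2

theorem not_observed_empty (v : V) : ¬ Observed G (∅ : Set V) v := by
  intro h
  induction h with
  | self v hv => exact hv
  | neighbor v w hv hw => exact hv
  | force v w _ hvw _ ih1 ih2 => exact ih1

/-- Two vertices outside `S` that have no neighbour in `S` are never observed if every vertex
adjacent to one of them is adjacent to the other one or is the other one. -/
theorem not_observed_of_twins {S : Set V} {a b : V} (hab : a ≠ b) (ha : a ∉ S) (hb : b ∉ S)
    (hSa : ∀ s ∈ S, ¬ G.Adj s a) (hSb : ∀ s ∈ S, ¬ G.Adj s b)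
    (htwin : ∀ x, x ≠ a → x ≠ b → (G.Adj x a ↔ G.Adj x b)) {v : V} (h : Observed G S v) :
    v ≠ a ∧ v ≠ b := by
  induction h with
  | self v hv => exact ⟨fun h => ha (h ▸ hv), fun h => hb (h ▸ hv)⟩
  | neighbor v w hv hw => exact ⟨fun h => hSa v hv (h ▸ hw), fun h => hSb v hv (h ▸ hw)⟩
  | force v w _ hvw _ ih1 ih2 =>
    refine ⟨?_, ?_⟩
    · rintro rfl
      exact (ih2 b ((htwin v ih1.1 ih1.2).1 hvw) hab.symm).2 rfl
    · rintro rfl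
      exact (ih2 a ((htwin v ih1.1 ih1.2).2 hvw) hab).1 rfl

end Observation

/-! ### From power dominating sets to robust multisets -/

section Robust

variable {V : Type u} {G : SimpleGraph V}

theorem robustPowerDominationNumber_le [DecidableEq V] {k : ℕ} {S : Multiset V}
    (h : IsRobustPowerDominating G k S) : robustPowerDominationNumber G k ≤ S.card :=
  Nat.sInf_le ⟨S, h, rfl⟩

theorem le_robustPowerDominationNumber [Fintype V] [DecidableEq V] [Nonempty V] {k m : ℕ}
    (h : ∀ S : Multiset V, IsRobustPowerDominating G k S → m ≤ S.card) :
    m ≤ robustPowerDominationNumber G k := by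
  obtain ⟨S, hS⟩ := exists_isRobustPowerDominating G k
  refine le_csInf ⟨_, S, hS, rfl⟩ ?_
  rintro _ ⟨T, hT, rfl⟩
  exact h T hT

theorem IsPowerDominating.nonempty [Nonempty V] {D : Finset V}
    (h : IsPowerDominating G (D : Set V)) : D.Nonempty := by
  rw [Finset.nonempty_iff_ne_empty]
  rintro rfl
  have := h (Classical.arbitrary V)
  rw [Finset.coe_empty] at this
  exact not_observed_empty _ this

/-- With `k + 1` copies of `D`, no `k` failures remove every copy of a vertex, so a full copy of `D`
survives. -/
theorem robustPowerDominationNumber_le_mul_card [DecidableEq V] [Nonempty V] (k : ℕ) {D : Finset V}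
    (h : IsPowerDominating G (D : Set V)) :
    robustPowerDominationNumber G k ≤ (k + 1) * D.card := by
  have hD := h.nonempty.card_pos
  have : IsRobustPowerDominating G k ((k + 1) • D.val) := by
    refine ⟨?_, fun F _ hF => ⟨D, ?_, h⟩⟩
    · simp only [Multiset.card_nsmul, Finset.card_val]
      nlinarith
    · rw [Multiset.le_iff_count]
      intro v
      have h1 := Multiset.count_le_card v F
      rw [Multiset.count_sub, Multiset.count_nsmul]
      by_cases hv : v ∈ D.val
      · rw [Multiset.count_eq_one_of_mem D.nodup hv]
        omega
      · rw [Multiset.count_eq_zero_of_notMem hv]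
        omega
  simpa using robustPowerDominationNumber_le this

end Robust

/-! ### Minimum sets, and criteria for `K₃,₃` and `𝒯` -/

section ExternalPrivate

open scoped Classical

variable {V : Type u} {G : SimpleGraph V}

theorem card_insert_erase {S : Finset V} {v u : V} (hv : v ∈ S) (hu : u ∉ S) :
    (insert u (S.erase v)).card = S.card := by
  rw [card_insert_of_notMem (fun h => hu (mem_of_mem_erase h)), card_erase_of_mem hv]
  have := card_pos.2 ⟨v, hv⟩
  omega

/-- `S` is a power dominating set of minimum cardinality. -/
structure IsMinimumPD (G : SimpleGraph V) (S : Finset V) : Prop where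
  pd : IsPowerDominating G (S : Set V)
  card_le : ∀ T : Finset V, IsPowerDominating G (T : Set V) → S.card ≤ T.card

theorem IsMinimumPD.not_erase {S : Finset V} (hS : IsMinimumPD G S) {v : V} (hv : v ∈ S) :
    ¬ IsPowerDominating G ((S.erase v : Finset V) : Set V) := by
  intro h
  have h1 := hS.card_le _ h
  rw [card_erase_of_mem hv] at h1
  have := card_pos.2 ⟨v, hv⟩
  omega

theorem IsMinimumPD.of_card_eq {S T : Finset V} (hS : IsMinimumPD G S)
    (hT : IsPowerDominating G (T : Set V)) (h : T.card = S.card) : IsMinimumPD G T :=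
  ⟨hT, fun U hU => h ▸ hS.card_le U hU⟩

theorem IsK33.of_vertices {v x x' u w w' : V}
    (hcover : ∀ y, y = v ∨ y = x ∨ y = x' ∨ y = u ∨ y = w ∨ y = w')
    (hvx : v ≠ x) (hvx' : v ≠ x') (hxx : x ≠ x') (huw : u ≠ w) (huw' : u ≠ w') (hww : w ≠ w')
    (h1 : G.Adj v u) (h2 : G.Adj v w) (h3 : G.Adj v w')
    (h4 : G.Adj x u) (h5 : G.Adj x w) (h6 : G.Adj x w')
    (h7 : G.Adj x' u) (h8 : G.Adj x' w) (h9 : G.Adj x' w')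
    (n1 : ¬ G.Adj v x) (n2 : ¬ G.Adj v x') (n3 : ¬ G.Adj x x')
    (n4 : ¬ G.Adj u w) (n5 : ¬ G.Adj u w') (n6 : ¬ G.Adj w w') : IsK33 G := by
  let f : Fin 3 ⊕ Fin 3 → V := Sum.elim ![v, x, x'] ![u, w, w']
  have hf : Function.Bijective f := by
    constructor
    · rintro (i | i) (j | j) h <;> fin_cases i <;> fin_cases j <;>
        simp_all [f]
    · intro y
      rcases hcover y with rfl | rfl | rfl | rfl | rfl | rfl
      exacts [⟨.inl 0, rfl⟩, ⟨.inl 1, rfl⟩, ⟨.inl 2, rfl⟩,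
        ⟨.inr 0, rfl⟩, ⟨.inr 1, rfl⟩, ⟨.inr 2, rfl⟩]
  refine ⟨(SimpleGraph.Iso.symm ⟨Equiv.ofBijective f hf, ?_⟩)⟩
  rintro (i | i) (j | j) <;> fin_cases i <;> fin_cases j <;>
    simp [f, h1, h2, h3, h4, h5, h6, h7, h8, h9, n1, n2, n3, n4, n5, n6,
      h1.symm, h2.symm, h3.symm, h4.symm, h5.symm, h6.symm, h7.symm, h8.symm, h9.symm,
      mt G.adj_symm n1, mt G.adj_symm n2, mt G.adj_symm n3,
      mt G.adj_symm n4, mt G.adj_symm n5, mt G.adj_symm n6]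

theorem inFamilyT_of_pendant_pairs (hG : G.Connected) {S : Finset V} (p q : V → V)
    (hp : ∀ v ∈ S, p v ∉ S) (hq : ∀ v ∈ S, q v ∉ S) (hpq : ∀ v ∈ S, p v ≠ q v)
    (hvp : ∀ v ∈ S, G.Adj v (p v)) (hvq : ∀ v ∈ S, G.Adj v (q v))
    (hpn : ∀ v ∈ S, ∀ x, G.Adj (p v) x → x = v ∨ x = q v)
    (hqn : ∀ v ∈ S, ∀ x, G.Adj (q v) x → x = v ∨ x = p v)
    (hcover : ∀ x, x ∈ S ∨ ∃ v ∈ S, x = p v ∨ x = q v) : InFamilyT G := by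
  have own_p : ∀ u ∈ S, ∀ v ∈ S, G.Adj u (p v) → u = v := fun u hu v hv h =>
    (hpn v hv u h.symm).resolve_right fun h => hq v hv (h ▸ hu)
  have own_q : ∀ u ∈ S, ∀ v ∈ S, G.Adj u (q v) → u = v := fun u hu v hv h =>
    (hqn v hv u h.symm).resolve_right fun h => hp v hv (h ▸ hu)
  let f : {v // v ∈ S} × Fin 3 → V := fun a => ![a.1.1, p a.1.1, q a.1.1] a.2
  have hf : Function.Bijective f := by
    constructor
    · rintro ⟨⟨u, hu⟩, i⟩ ⟨⟨v, hv⟩, j⟩ h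
      fin_cases i <;> fin_cases j <;> simp [f] at h ⊢
      · exact h
      · exact hp v hv (h ▸ hu)
      · exact hq v hv (h ▸ hu)
      · exact hp u hu (h ▸ hv)
      · exact own_p u hu v hv (h ▸ hvp u hu)
      · obtain rfl := own_q u hu v hv (h ▸ hvp u hu)
        exact hpq u hu h
      · exact hq u hu (h ▸ hv)
      · obtain rfl := own_p u hu v hv (h ▸ hvq u hu)
        exact hpq u hu h.symm
      · exact own_q u hu v hv (h ▸ hvq u hu)
    · intro x
      rcases hcover x with h | ⟨v, hv, rfl | rfl⟩
      exacts [⟨(⟨x, h⟩, 0), rfl⟩, ⟨(⟨v, hv⟩, 1), rfl⟩, ⟨(⟨v, hv⟩, 2), rfl⟩]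
  let H : SimpleGraph {v // v ∈ S} := G.comap Subtype.val
  let A : Set {v // v ∈ S} := {v | G.Adj (p v.1) (q v.1)}
  have hadj : ∀ a b, G.Adj (f a) (f b) ↔ (attachPairs H A).Adj a b := by
    rintro ⟨⟨u, hu⟩, i⟩ ⟨⟨v, hv⟩, j⟩
    fin_cases i <;> fin_cases j <;> simp [f, attachPairs, H, A]
    · exact ⟨fun h => ⟨h.ne, .inl h⟩, fun h => h.2.elim id G.adj_symm⟩
    · exact ⟨own_p u hu v hv, fun h => h ▸ hvp u hu⟩
    · exact ⟨own_q u hu v hv, fun h => h ▸ hvq u hu⟩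
    · exact ⟨fun h => own_p v hv u hu h.symm, fun h => h ▸ (hvp v hv).symm⟩
    · exact fun h => (hpn u hu _ h).elim (fun h => hp v hv (h ▸ hu)) fun h =>
        hpq u hu (by
          obtain rfl := own_q v hv u hu (h ▸ hvp v hv)
          exact h)
    · constructor
      · intro h
        rcases hpn u hu _ h with h' | h'
        · exact absurd hu (h' ▸ hq v hv)
        · obtain rfl := own_q v hv u hu (h' ▸ hvq v hv)
          exact ⟨rfl, h⟩
      · rintro ⟨rfl, h⟩
        exact h
    · exact ⟨fun h => own_q v hv u hu h.symm, fun h => h ▸ (hvq v hv).symm⟩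
    · constructor
      · intro h
        rcases hqn u hu _ h with h' | h'
        · exact absurd hu (h' ▸ hp v hv)
        · obtain rfl := own_p v hv u hu (h' ▸ hvp v hv)
          exact ⟨rfl, h.symm⟩
      · rintro ⟨rfl, h⟩
        exact h.symm
    · exact fun h => (hqn u hu _ h).elim (fun h => hq v hv (h ▸ hu)) fun h =>
        hpq u hu (by
          obtain rfl := own_p v hv u hu (h ▸ hvq v hv)
          exact h.symm)
  let e := Equiv.ofBijective f hf
  -- Collapsing each triple to its vertex in `S` sends an edge of `G` to an edge of `H` or to a
  -- point, so connectedness descends to `H`.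
  let r : V → {v // v ∈ S} := fun x => (e.symm x).1
  have hr : ∀ x y, G.Adj x y → r x = r y ∨ H.Adj (r x) (r y) := by
    intro x y hxy
    have h := (hadj (e.symm x) (e.symm y)).1 (by
      change G.Adj (e (e.symm x)) (e (e.symm y))
      simpa using hxy)
    simp only [attachPairs, SimpleGraph.fromRel_adj] at h
    have := fun h : H.Adj (e.symm y).1 (e.symm x).1 => h.symm
    simp only [r]
    tauto
  have hreach : ∀ x y, G.Reachable x y → H.Reachable (r x) (r y) := by
    rintro x y ⟨W⟩
    induction W with
    | nil => exact .refl _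
    | cons h _ ih =>
      rcases hr _ _ h with h | h
      · exact h ▸ ih
      · exact h.reachable.trans ih
  have hrS : ∀ v : {v // v ∈ S}, r v.1 = v := fun v => by
    have : e.symm v.1 = (v, 0) := e.symm_apply_eq.2 rfl
    simp [r, this]
  have hne : Nonempty {v // v ∈ S} := hG.nonempty.map r
  refine ⟨{v // v ∈ S}, H, A, ?_, ⟨(SimpleGraph.Iso.symm ⟨e, fun {a b} => hadj a b⟩)⟩⟩
  refine SimpleGraph.Connected.mk fun u v => ?_
  have := hreach u.1 v.1 (hG.preconnected _ _)
  rwa [hrS, hrS] at this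

/-! ### External private neighbours and exchanges -/

variable [Fintype V]

/-- The neighbours of `v` outside `S` that have no neighbour in `S` other than `v`. -/
noncomputable def externalPrivate (G : SimpleGraph V) (S : Finset V) (v : V) : Finset V :=
  univ.filter fun w => w ∉ S ∧ G.Adj v w ∧ ∀ s ∈ S, G.Adj s w → s = v

theorem mem_externalPrivate {S : Finset V} {v w : V} :
    w ∈ externalPrivate G S v ↔ w ∉ S ∧ G.Adj v w ∧ ∀ s ∈ S, G.Adj s w → s = v := by
  simp [externalPrivate]

/-- The ordered pairs of adjacent vertices of `S`. -/
noncomputable def innerDarts (G : SimpleGraph V) (S : Finset V) : Finset (V × V) :=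
  univ.filter fun p => p.1 ∈ S ∧ p.2 ∈ S ∧ G.Adj p.1 p.2

theorem mem_innerDarts {S : Finset V} {p : V × V} :
    p ∈ innerDarts G S ↔ p.1 ∈ S ∧ p.2 ∈ S ∧ G.Adj p.1 p.2 := by
  simp [innerDarts]

/-- `S` is a minimum power dominating set inducing as many edges as possible. -/
structure IsDensePD (G : SimpleGraph V) (S : Finset V) : Prop extends IsMinimumPD G S where
  darts_le : ∀ T : Finset V, IsMinimumPD G T → (innerDarts G T).card ≤ (innerDarts G S).card

/-- A vertex without neighbours in `S` takes no induced edge with it when it leaves. -/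
theorem innerDarts_subset_swap {S : Finset V} {v u : V} (hv : ∀ s ∈ S, ¬ G.Adj v s) :
    innerDarts G S ⊆ innerDarts G (insert u (S.erase v)) := by
  rintro ⟨a, b⟩ h
  obtain ⟨ha, hb, hab⟩ := mem_innerDarts.1 h
  simp only at ha hb hab
  refine mem_innerDarts.2 ⟨mem_insert_of_mem (mem_erase.2 ⟨?_, ha⟩),
    mem_insert_of_mem (mem_erase.2 ⟨?_, hb⟩), hab⟩
  · rintro rfl; exact hv b hb hab
  · rintro rfl; exact hv a ha hab.symm

/-- Moving a vertex `v` with at most one external private neighbour to one of its neighbours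
preserves power domination. -/
theorem isPowerDominating_swap {S : Finset V} (hS : IsPowerDominating G (S : Set V)) {v u : V}
    (hep : ∀ a ∈ externalPrivate G S v, ∀ b ∈ externalPrivate G S v, a = b)
    (hvu : G.Adj v u) : IsPowerDominating G ((insert u (S.erase v) : Finset V) : Set V) := by
  intro y
  have hv : Observed G ((insert u (S.erase v) : Finset V) : Set V) v :=
    .neighbor u v (by simp) hvu.symm
  have key : ∀ w, G.Adj v w → w ∉ externalPrivate G S v →
      Observed G ((insert u (S.erase v) : Finset V) : Set V) w := by
    intro w hw hn
    rw [mem_externalPrivate] at hn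
    by_cases hwS : w ∈ S
    · exact .self w (by simp [hwS, hw.ne'])
    · push Not at hn
      obtain ⟨s, hs, hsw, hsv⟩ := hn hwS hw
      exact .neighbor s w (by simp [hs, hsv]) hsw
  -- It suffices to observe the closed neighbourhood of the old set; its later forcing steps can
  -- then be replayed.
  refine Observed.trans ?_ ?_ (hS y)
  · intro s hs
    by_cases hsv : s = v
    · exact hsv ▸ hv
    · exact .self s (by simp [hsv, mem_coe.1 hs])
  · intro s hs w hw
    by_cases hsv : s = v
    · subst hsv
      by_cases hwe : w ∈ externalPrivate G S s
      · exact .force s w hv hw fun x hx hxw =>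
          key x hx fun hxe => hxw (hep _ hxe _ hwe)
      · exact key w hw hwe
    · exact .neighbor s w (by simp [hsv, mem_coe.1 hs]) hw

/-- A vertex with at most one external private neighbour that has a neighbour in `S` may be
dropped. -/
theorem isPowerDominating_erase {S : Finset V} (hS : IsPowerDominating G (S : Set V)) {v u : V}
    (hep : ∀ a ∈ externalPrivate G S v, ∀ b ∈ externalPrivate G S v, a = b)
    (hu : u ∈ S) (hvu : G.Adj v u) : IsPowerDominating G ((S.erase v : Finset V) : Set V) := by
  have := isPowerDominating_swap hS hep hvu
  rwa [insert_eq_of_mem (mem_erase.2 ⟨hvu.ne', hu⟩)] at this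

theorem IsMinimumPD.isolated {S : Finset V} (hS : IsMinimumPD G S) {v : V} (hv : v ∈ S)
    (hep : ∀ a ∈ externalPrivate G S v, ∀ b ∈ externalPrivate G S v, a = b) :
    ∀ s ∈ S, ¬ G.Adj v s := fun _ hs hvs =>
  hS.not_erase hv (isPowerDominating_erase hS.pd hep hs hvs)

theorem IsDensePD.of_swap {S : Finset V} (hS : IsDensePD G S) {v u : V}
    (hv : ∀ s ∈ S, ¬ G.Adj v s)
    (hT : IsMinimumPD G (insert u (S.erase v))) : IsDensePD G (insert u (S.erase v)) :=
  ⟨hT, fun U hU => (hS.darts_le U hU).trans (card_le_card (innerDarts_subset_swap hv))⟩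

/-- In a dense minimum power dominating set, a vertex with at most one external private neighbour
has no other neighbours. -/
theorem IsDensePD.mem_externalPrivate_of_adj {S : Finset V} (hS : IsDensePD G S) {v : V}
    (hv : v ∈ S) (hep : ∀ a ∈ externalPrivate G S v, ∀ b ∈ externalPrivate G S v, a = b)
    {w : V} (hw : G.Adj v w) : w ∈ externalPrivate G S v := by
  have hiso := hS.toIsMinimumPD.isolated hv hep
  by_contra hn
  have hwS : w ∉ S := fun h => hiso w h hw
  have hn' := hn
  rw [mem_externalPrivate] at hn'
  push Not at hn'
  obtain ⟨s, hs, hsw, hsv⟩ := hn' hwS hw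
  have hT : IsMinimumPD G (insert w (S.erase v)) :=
    hS.toIsMinimumPD.of_card_eq (isPowerDominating_swap hS.pd hep hw) (card_insert_erase hv hwS)
  have h1 := hS.darts_le _ hT
  have h2 : (innerDarts G S).card < (innerDarts G (insert w (S.erase v))).card := by
    refine card_lt_card ⟨innerDarts_subset_swap hiso, fun h => ?_⟩
    have : (s, w) ∈ innerDarts G (insert w (S.erase v)) :=
      mem_innerDarts.2 ⟨by simp [hs, hsv], by simp, hsw⟩
    exact hwS (mem_innerDarts.1 (h this)).2.1
  omega

theorem exists_isMinimumPD (G : SimpleGraph V) : ∃ S : Finset V, IsMinimumPD G S := by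
  obtain ⟨S, hS, h⟩ := exists_min_image
    (univ.filter fun S : Finset V => IsPowerDominating G (S : Set V)) card
    ⟨univ, mem_filter.2 ⟨mem_univ _, fun v => Observed.self v (by simp)⟩⟩
  exact ⟨S, (mem_filter.1 hS).2, fun T hT => h T (by simpa using hT)⟩

theorem exists_isDensePD (G : SimpleGraph V) : ∃ S : Finset V, IsDensePD G S := by
  obtain ⟨S₀, hS₀⟩ := exists_isMinimumPD G
  obtain ⟨S, hS, h⟩ := exists_max_image
    (univ.filter fun S : Finset V => IsMinimumPD G S) (fun S => (innerDarts G S).card)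
    ⟨S₀, by simpa using hS₀⟩
  exact ⟨S, (mem_filter.1 hS).2, fun T hT => h T (by simpa using hT)⟩

/-- A leaf of a connected graph with at least three vertices is adjacent to a non-leaf. -/
theorem exists_adj_ne_of_leaf (hG : G.Connected) (hn : 3 ≤ Fintype.card V) {v p : V}
    (hvp : G.Adj v p) (hleaf : ∀ w, G.Adj v w → w = p) : ∃ w, G.Adj p w ∧ w ≠ v := by
  by_contra! hc
  have hcl : ∀ a b, G.Reachable a b → a = v ∨ a = p → b = v ∨ b = p := by
    rintro a b ⟨W⟩
    induction W with
    | nil => exact id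
    | cons h _ ih =>
      rintro (rfl | rfl)
      · exact ih (.inr (hleaf _ h))
      · exact ih (.inl (hc _ h))
  have : (univ : Finset V) ⊆ {v, p} := fun b _ => by
    simpa using hcl v b (hG.preconnected v b) (.inl rfl)
  have := (card_le_card this).trans card_le_two
  rw [card_univ] at this
  omega

theorem exists_isDensePD_two_le (hG : G.Connected) (hn : 3 ≤ Fintype.card V) :
    ∃ S : Finset V, IsDensePD G S ∧ ∀ v ∈ S, 2 ≤ (externalPrivate G S v).card := by
  -- `L` consists of the vertices of degree at least two. Maximising `|S ∩ L|` is a tie-break among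
  -- dense sets, needed only when `v` turns out to be a leaf.
  let L : Finset V := univ.filter fun v => ∃ a b, G.Adj v a ∧ G.Adj v b ∧ a ≠ b
  obtain ⟨S₀, hS₀⟩ := exists_isDensePD G
  obtain ⟨S, hS, hmax⟩ := exists_max_image
    (univ.filter fun S : Finset V => IsDensePD G S) (fun S => (S ∩ L).card)
    ⟨S₀, by simpa using hS₀⟩
  replace hS : IsDensePD G S := (mem_filter.1 hS).2
  refine ⟨S, hS, fun v hv => ?_⟩
  by_contra hlt
  have hep : ∀ a ∈ externalPrivate G S v, ∀ b ∈ externalPrivate G S v, a = b :=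
    card_le_one.1 (by omega)
  have hadj := fun w (hw : G.Adj v w) => hS.mem_externalPrivate_of_adj hv hep hw
  have hiso := hS.toIsMinimumPD.isolated hv hep
  have : Nontrivial V := Fintype.one_lt_card_iff_nontrivial.1 (by omega)
  obtain ⟨p, hvp⟩ := hG.preconnected.exists_adj_of_nontrivial v
  have hleaf : ∀ w, G.Adj v w → w = p := fun w hw => hep _ (hadj w hw) _ (hadj p hvp)
  have hpS : p ∉ S := (mem_externalPrivate.1 (hadj p hvp)).1
  obtain ⟨w, hpw, hwv⟩ := exists_adj_ne_of_leaf hG hn hvp hleaf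
  have hT : IsDensePD G (insert p (S.erase v)) := hS.of_swap hiso
    (hS.toIsMinimumPD.of_card_eq (isPowerDominating_swap hS.pd hep hvp)
      (card_insert_erase hv hpS))
  have h1 := hmax _ (by simpa using hT)
  have hpL : p ∈ L := by
    simp only [L, mem_filter, mem_univ, true_and]
    exact ⟨v, w, hvp.symm, hpw, hwv.symm⟩
  have h2 : (S ∩ L).card < (insert p (S.erase v) ∩ L).card := by
    refine card_lt_card ⟨fun x hx => ?_, fun h => hpS ?_⟩
    · rw [mem_inter] at hx
      refine mem_inter.2 ⟨mem_insert_of_mem (mem_erase.2 ⟨?_, hx.1⟩), hx.2⟩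
      rintro rfl
      obtain ⟨a, b, ha, hb, hab⟩ := (mem_filter.1 hx.2).2
      exact hab ((hleaf a ha).trans (hleaf b hb).symm)
    · exact (mem_inter.1 (h (mem_inter.2 ⟨mem_insert_self _ _, hpL⟩))).1
  omega

/-- The union is disjoint because a private neighbour determines the vertex of `S` it belongs to. -/
theorem card_add_sum_card_externalPrivate (S : Finset V) :
    (S ∪ S.biUnion (externalPrivate G S)).card
      = S.card + ∑ v ∈ S, (externalPrivate G S v).card := by
  rw [card_union_of_disjoint, card_biUnion]
  · intro v hv u hu hvu
    refine Finset.disjoint_left.2 fun w hw hw' => hvu ?_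
    exact (mem_externalPrivate.1 hw').2.2 v hv (mem_externalPrivate.1 hw).2.1
  · refine Finset.disjoint_left.2 fun w hw hw' => ?_
    obtain ⟨v, _, h⟩ := mem_biUnion.1 hw'
    exact (mem_externalPrivate.1 h).1 hw

theorem three_mul_card_le {S : Finset V} (h : ∀ v ∈ S, 2 ≤ (externalPrivate G S v).card) :
    3 * S.card ≤ Fintype.card V := by
  have h1 := card_le_univ (S ∪ S.biUnion (externalPrivate G S))
  rw [card_add_sum_card_externalPrivate] at h1
  have h2 := card_nsmul_le_sum S _ 2 h
  rw [smul_eq_mul] at h2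
  omega

/-- A dense minimum power dominating set that, together with two external private neighbours for
each of its vertices, covers the graph exactly. -/
structure IsTightPD (G : SimpleGraph V) (S : Finset V) : Prop extends IsDensePD G S where
  card_two : ∀ v ∈ S, (externalPrivate G S v).card = 2
  cover : ∀ w, w ∉ S → ∃ v ∈ S, w ∈ externalPrivate G S v

/-- Equality leaves no slack in the count: a third private neighbour or an uncovered vertex would
exceed `n`. -/
theorem IsDensePD.isTightPD {S : Finset V} (hS : IsDensePD G S)
    (h : ∀ v ∈ S, 2 ≤ (externalPrivate G S v).card) (hc : 3 * S.card = Fintype.card V) :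
    IsTightPD G S := by
  have h1 := card_le_univ (S ∪ S.biUnion (externalPrivate G S))
  have h0 := card_add_sum_card_externalPrivate (G := G) S
  have h2 := card_nsmul_le_sum S _ 2 h
  rw [smul_eq_mul] at h2
  refine ⟨hS, fun v hv => ?_, fun w hw => ?_⟩
  · by_contra hne
    have hlt : ∑ v ∈ S, 2 < ∑ v ∈ S, (externalPrivate G S v).card :=
      sum_lt_sum h ⟨v, hv, lt_of_le_of_ne (h v hv) (Ne.symm hne)⟩
    rw [sum_const, smul_eq_mul] at hlt
    omega
  · have : S ∪ S.biUnion (externalPrivate G S) = univ := by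
      rw [← card_eq_iff_eq_univ]
      omega
    have hw' : w ∈ S ∪ S.biUnion (externalPrivate G S) := this ▸ mem_univ w
    rcases mem_union.1 hw' with h | h
    · exact absurd h hw
    · simpa using h

/-! ### The equality case `3|S| = n` -/

namespace IsTightPD

variable {S : Finset V}

/-- By `cover`, every vertex outside the triple of `v` is in `S` or is private to another vertex of
`S`, so dropping `v` does not affect it. -/
theorem observed_erase (hS : IsTightPD G S) {v x : V} (hxv : x ≠ v)
    (hx : x ∉ externalPrivate G S v) :
    Observed G ((S.erase v : Finset V) : Set V) x := by
  by_cases hxS : x ∈ S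
  · exact .self x (by simp [hxS, hxv])
  · obtain ⟨u, hu, hxu⟩ := hS.cover x hxS
    have : u ≠ v := by rintro rfl; exact hx hxu
    exact .neighbor u x (by simp [hu, this]) (mem_externalPrivate.1 hxu).2.1

/-- The two external private neighbours of a non-isolated vertex of `S` have the same
neighbours outside their triple. -/
theorem twins (hS : IsTightPD G S) {v s x w w' : V} (hv : v ∈ S) (hs : s ∈ S)
    (hvs : G.Adj v s) (hw : w ∈ externalPrivate G S v) (hw' : w' ∈ externalPrivate G S v)
    (hxv : x ≠ v) (hx : x ∉ externalPrivate G S v) (hwx : G.Adj w x) : G.Adj w' x := by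
  by_contra hn
  have hww : w ≠ w' := by rintro rfl; exact hn hwx
  have hpair : ∀ y ∈ externalPrivate G S v, y = w ∨ y = w' := by
    have : ({w, w'} : Finset V) = externalPrivate G S v :=
      eq_of_subset_of_card_le (by simp [insert_subset_iff, hw, hw'])
        (by rw [hS.card_two v hv, card_pair hww])
    intro y hy
    simpa [← this] using hy
  -- If `x` is adjacent to `w` but not to `w'`, then `v` is superfluous: `s` observes `v`, then `x`
  -- forces `w`, and finally `v` forces `w'`.
  refine hS.toIsMinimumPD.not_erase hv fun y => ?_
  have hov : Observed G ((S.erase v : Finset V) : Set V) v :=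
    .neighbor s v (by simp [hs, hvs.ne']) hvs.symm
  have how : Observed G ((S.erase v : Finset V) : Set V) w := by
    refine .force x w (hS.observed_erase hxv hx) hwx.symm fun z hxz hzw => ?_
    by_cases hzv : z = v
    · exact hzv ▸ hov
    refine hS.observed_erase hzv fun hz => ?_
    rcases hpair z hz with rfl | rfl
    · exact hzw rfl
    · exact hn hxz.symm
  have how' : Observed G ((S.erase v : Finset V) : Set V) w' := by
    refine .force v w' hov (mem_externalPrivate.1 hw').2.1 fun z hvz hzw => ?_
    by_cases hz : z ∈ externalPrivate G S v
    · rcases hpair z hz with rfl | rfl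
      · exact how
      · exact absurd rfl hzw
    · exact hS.observed_erase hvz.ne' hz
  by_cases hyv : y = v
  · exact hyv ▸ hov
  by_cases hy : y ∈ externalPrivate G S v
  · rcases hpair y hy with rfl | rfl
    · exact how
    · exact how'
  · exact hS.observed_erase hyv hy

theorem pair (hS : IsTightPD G S) {v w : V} (hv : v ∈ S) (hw : w ∈ externalPrivate G S v) :
    ∃ w' ∈ externalPrivate G S v, w ≠ w' ∧ ∀ y ∈ externalPrivate G S v, y = w ∨ y = w' := by
  obtain ⟨a, b, hab, h⟩ := card_eq_two.1 (hS.card_two v hv)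
  rw [h] at hw ⊢
  simp only [mem_insert, mem_singleton] at hw ⊢
  rcases hw with rfl | rfl
  · exact ⟨b, .inr rfl, hab, fun y => id⟩
  · exact ⟨a, .inl rfl, hab.symm, fun y => Or.symm⟩

/-- The new vertex `w` observes `v`, whose only possibly unobserved neighbour is then the other
private one, which `v` forces. -/
theorem isPowerDominating_move (hS : IsTightPD G S) {v w : V} (hv : v ∈ S)
    (hw : w ∈ externalPrivate G S v) :
    IsPowerDominating G ((insert w (S.erase v) : Finset V) : Set V) := by
  obtain ⟨w', hw', hww, hpair⟩ := hS.pair hv hw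
  have mono : ∀ y, Observed G ((S.erase v : Finset V) : Set V) y →
      Observed G ((insert w (S.erase v) : Finset V) : Set V) y := fun y hy =>
    Observed.trans (fun s hs => .self s (by simpa using Or.inr (by simpa using hs)))
      (fun s hs z hz => .neighbor s z (by simpa using Or.inr (by simpa using hs)) hz) hy
  have hov : Observed G ((insert w (S.erase v) : Finset V) : Set V) v :=
    .neighbor w v (by simp) (mem_externalPrivate.1 hw).2.1.symm
  have how : Observed G ((insert w (S.erase v) : Finset V) : Set V) w := .self w (by simp)
  intro y
  by_cases hyv : y = v
  · exact hyv ▸ hov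
  by_cases hy : y ∈ externalPrivate G S v
  · rcases hpair y hy with rfl | rfl
    · exact how
    · refine .force v y hov (mem_externalPrivate.1 hw').2.1 fun z hvz hzw => ?_
      by_cases hz : z ∈ externalPrivate G S v
      · rcases hpair z hz with rfl | rfl
        · exact how
        · exact absurd rfl hzw
      · exact mono z (hS.observed_erase hvz.ne' hz)
  · exact mono y (hS.observed_erase hyv hy)

/-- After moving from `v` to its private neighbour `w`, a vertex `u` one of whose private
neighbours is adjacent to `w` has at most one private neighbour. -/
theorem externalPrivate_move (hS : IsTightPD G S) {v w u x : V}
    (hv : v ∈ S) (hw : w ∈ externalPrivate G S v) (hu : u ∈ S) (huv : u ≠ v)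
    (hx : x ∈ externalPrivate G S u) (hwx : G.Adj w x) :
    ∀ a ∈ externalPrivate G (insert w (S.erase v)) u,
      ∀ b ∈ externalPrivate G (insert w (S.erase v)) u, a = b := by
  obtain ⟨x', hx', hxx, hpair⟩ := hS.pair hu hx
  have key : ∀ a ∈ externalPrivate G (insert w (S.erase v)) u, a = x' := by
    intro a ha
    obtain ⟨h1, h2, h3⟩ := mem_externalPrivate.1 ha
    have hwu : w ≠ u := by rintro rfl; exact (mem_externalPrivate.1 hw).1 hu
    have hwa : ¬ G.Adj w a := fun h => hwu (h3 w (mem_insert_self _ _) h)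
    have hav : a ≠ v := by
      rintro rfl
      exact hwa (mem_externalPrivate.1 hw).2.1.symm
    have haS : a ∉ S := fun h => h1 (by simp [h, hav])
    obtain ⟨z, hz, haz⟩ := hS.cover a haS
    obtain rfl : u = z := (mem_externalPrivate.1 haz).2.2 u hu h2
    rcases hpair a haz with rfl | h
    · exact absurd hwx hwa
    · exact h
  intro a ha b hb
  rw [key a ha, key b hb]

/-- After the move from `v` to `w` the set is still minimum, and `u` has at most one private
neighbour left, hence no neighbour in the new set. -/
theorem move_isolated (hS : IsTightPD G S) {v w u x : V}
    (hv : v ∈ S) (hw : w ∈ externalPrivate G S v) (hu : u ∈ S) (huv : u ≠ v)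
    (hx : x ∈ externalPrivate G S u) (hwx : G.Adj w x) {s : V} (hs : s ∈ S)
    (hus : G.Adj u s) : s = v := by
  by_contra hsv
  have hT : IsMinimumPD G (insert w (S.erase v)) :=
    hS.toIsMinimumPD.of_card_eq (hS.isPowerDominating_move hv hw)
      (card_insert_erase hv (mem_externalPrivate.1 hw).1)
  exact hT.isolated (v := u) (by simp [hu, huv])
    (hS.externalPrivate_move hv hw hu huv hx hwx) s (by simp [hs, hsv]) hus

/-- If `v` had no neighbour in `S`, moving it to `w` would preserve density. Then `x` would have to
be private to `u`, although `w` also observes it. -/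
theorem exists_adj (hS : IsTightPD G S) {v w u x : V}
    (hv : v ∈ S) (hw : w ∈ externalPrivate G S v) (hu : u ∈ S) (huv : u ≠ v)
    (hx : x ∈ externalPrivate G S u) (hwx : G.Adj w x) : ∃ s ∈ S, G.Adj v s := by
  by_contra! hiso
  have hT : IsDensePD G (insert w (S.erase v)) := hS.toIsDensePD.of_swap hiso
    (hS.toIsMinimumPD.of_card_eq (hS.isPowerDominating_move hv hw)
      (card_insert_erase hv (mem_externalPrivate.1 hw).1))
  have := hT.mem_externalPrivate_of_adj (v := u) (by simp [hu, huv])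
    (hS.externalPrivate_move hv hw hu huv hx hwx) (mem_externalPrivate.1 hx).2.1
  have hwu := (mem_externalPrivate.1 this).2.2 w (mem_insert_self _ _) hwx
  exact (mem_externalPrivate.1 hw).1 (hwu ▸ hu)

theorem adj_of_cross (hS : IsTightPD G S) {v w u x : V}
    (hv : v ∈ S) (hw : w ∈ externalPrivate G S v) (hu : u ∈ S) (huv : u ≠ v)
    (hx : x ∈ externalPrivate G S u) (hwx : G.Adj w x) :
    G.Adj v u ∧ ∀ s ∈ S, G.Adj v s → s = u := by
  have h : ∀ s ∈ S, G.Adj v s → s = u := fun s hs hvs =>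
    hS.move_isolated hu hx hv huv.symm hw hwx.symm hs hvs
  obtain ⟨s, hs, hvs⟩ := hS.exists_adj hv hw hu huv hx hwx
  exact ⟨h s hs hvs ▸ hvs, h⟩

end IsTightPD

/-- An edge between the private neighbours of different vertices forces `K₃,₃`. -/
theorem IsTightPD.isK33 {S : Finset V} (hS : IsTightPD G S) (hG : G.Connected) {v w u x : V}
    (hv : v ∈ S) (hw : w ∈ externalPrivate G S v) (hu : u ∈ S) (huv : u ≠ v)
    (hx : x ∈ externalPrivate G S u) (hwx : G.Adj w x) : IsK33 G := by
  obtain ⟨w', hw', hww, hwpair⟩ := hS.pair hv hw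
  obtain ⟨x', hx', hxx, hxpair⟩ := hS.pair hu hx
  obtain ⟨hvu, hvS⟩ := hS.adj_of_cross hv hw hu huv hx hwx
  obtain ⟨-, huS⟩ := hS.adj_of_cross hu hx hv huv.symm hw hwx.symm
  have Pw := mem_externalPrivate.1 hw
  have Pw' := mem_externalPrivate.1 hw'
  have Px := mem_externalPrivate.1 hx
  have Px' := mem_externalPrivate.1 hx'
  have outer : ∀ {y}, y ∈ externalPrivate G S u → y ≠ v ∧ y ∉ externalPrivate G S v := by
    intro y hy
    have Py := mem_externalPrivate.1 hy
    exact ⟨fun h => Py.1 (h ▸ hv),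
      fun h => huv ((mem_externalPrivate.1 h).2.2 u hu Py.2.1)⟩
  have outer' : ∀ {y}, y ∈ externalPrivate G S v → y ≠ u ∧ y ∉ externalPrivate G S u := by
    intro y hy
    have Py := mem_externalPrivate.1 hy
    exact ⟨fun h => Py.1 (h ▸ hu),
      fun h => huv ((mem_externalPrivate.1 h).2.2 v hv Py.2.1).symm⟩
  have hw'x : G.Adj w' x := hS.twins hv hu hvu hw hw' (outer hx).1 (outer hx).2 hwx
  have hx'w : G.Adj x' w := hS.twins hu hv hvu.symm hx hx' (outer' hw).1 (outer' hw).2 hwx.symm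
  have hx'w' : G.Adj x' w' :=
    hS.twins hu hv hvu.symm hx hx' (outer' hw').1 (outer' hw').2 hw'x.symm
  have closedS : ∀ a ∈ S, (∀ s ∈ S, G.Adj a s → s = u ∨ s = v) → ∀ y, G.Adj a y →
      y ∈ externalPrivate G S a ∨ y = u ∨ y = v := by
    intro a ha haS y hy
    by_cases hyS : y ∈ S
    · exact .inr (haS y hyS hy)
    · obtain ⟨z, hz, hyz⟩ := hS.cover y hyS
      obtain rfl := (mem_externalPrivate.1 hyz).2.2 a ha hy
      exact .inl hyz
  have closedP : ∀ a ∈ S, ∀ b ∈ S, (G.Adj a b) → (∀ s ∈ S, G.Adj a s → s = b) →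
      ∀ y ∈ externalPrivate G S a, ∀ z, G.Adj y z →
      z = a ∨ z ∈ externalPrivate G S a ∨ z ∈ externalPrivate G S b := by
    intro a ha b hb hab haS y hy z hyz
    by_cases hzS : z ∈ S
    · exact .inl ((mem_externalPrivate.1 hy).2.2 z hzS hyz.symm)
    · obtain ⟨c, hc, hzc⟩ := hS.cover z hzS
      by_cases hca : c = a
      · exact .inr (.inl (hca ▸ hzc))
      · have h := (hS.adj_of_cross ha hy hc hca hzc hyz).2 b hb hab
        exact .inr (.inr (h ▸ hzc))
  -- The two triples are closed under adjacency, so by connectedness they are the whole graph.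
  have hcover : ∀ y, y = v ∨ y = x ∨ y = x' ∨ y = u ∨ y = w ∨ y = w' := by
    have hcl : ∀ a b, G.Reachable a b →
        (a = v ∨ a = u ∨ a ∈ externalPrivate G S v ∨ a ∈ externalPrivate G S u) →
        (b = v ∨ b = u ∨ b ∈ externalPrivate G S v ∨ b ∈ externalPrivate G S u) := by
      rintro a b ⟨W⟩
      induction W with
      | nil => exact id
      | cons h _ ih =>
        rintro (rfl | rfl | ha | ha) <;> apply ih
        · rcases closedS _ hv (fun s hs h => .inl (hvS s hs h)) _ h with h | h | h <;> simp [h]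
        · rcases closedS _ hu (fun s hs h => .inr (huS s hs h)) _ h with h | h | h <;> simp [h]
        · rcases closedP v hv u hu hvu hvS _ ha _ h with h | h | h <;> simp [h]
        · rcases closedP u hu v hv hvu.symm huS _ ha _ h with h | h | h <;> simp [h]
    intro y
    rcases hcl v y (hG.preconnected v y) (.inl rfl) with h | h | h | h
    · exact .inl h
    · exact .inr (.inr (.inr (.inl h)))
    · rcases hwpair y h with h | h <;> simp [h]
    · rcases hxpair y h with h | h <;> simp [h]
  have hcardS : 2 ≤ S.card := by
    rw [← card_pair huv]
    exact card_le_card (by simp [insert_subset_iff, hu, hv])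
  -- A further edge would make a single vertex power dominating.
  have single : ∀ a b b' c d d', G.Adj b a → G.Adj b b' → G.Adj b d → G.Adj b d' → G.Adj a c →
      (∀ y, y = a ∨ y = d ∨ y = d' ∨ y = c ∨ y = b ∨ y = b') → False := by
    intro a b b' c d d' h1 h2 h3 h4 h5 hcov
    have : IsPowerDominating G (({b} : Finset V) : Set V) := by
      have ho : ∀ y, y ≠ c → Observed G (({b} : Finset V) : Set V) y := by
        intro y hy
        rcases hcov y with rfl | rfl | rfl | rfl | rfl | rfl
        · exact .neighbor b _ (by simp) h1
        · exact .neighbor b _ (by simp) h3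
        · exact .neighbor b _ (by simp) h4
        · exact absurd rfl hy
        · exact .self _ (by simp)
        · exact .neighbor b _ (by simp) h2
      intro y
      by_cases hy : y = c
      · subst hy
        exact .force a y (ho a h5.ne) h5 fun z _ hz => ho z hz
      · exact ho y hy
    have := hS.card_le _ this
    rw [card_singleton] at this
    omega
  have nww : ¬ G.Adj w w' := fun h =>
    single v w w' u x x' Pw.2.1.symm h hwx hx'w.symm hvu hcover
  have nxx : ¬ G.Adj x x' := fun h =>
    single u x x' v w w' Px.2.1.symm h hwx.symm hw'x.symm hvu.symm fun y => by
      rcases hcover y with h | h | h | h | h | h <;> simp [h]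
  exact IsK33.of_vertices hcover (outer hx).1.symm (outer hx').1.symm hxx (outer' hw).1.symm
    (outer' hw').1.symm hww hvu Pw.2.1 Pw'.2.1 Px.2.1.symm hwx.symm hw'x.symm Px'.2.1.symm
    hx'w hx'w'
    (fun h => huv (Px.2.2 v hv h).symm) (fun h => huv (Px'.2.2 v hv h).symm) nxx
    (fun h => huv (Pw.2.2 u hu h)) (fun h => huv (Pw'.2.2 u hu h)) nww

theorem IsTightPD.inFamilyT_or_isK33 {S : Finset V} (hS : IsTightPD G S) (hG : G.Connected) :
    InFamilyT G ∨ IsK33 G := by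
  by_cases hc : ∃ v w u x, v ∈ S ∧ w ∈ externalPrivate G S v ∧ u ∈ S ∧ u ≠ v ∧
      x ∈ externalPrivate G S u ∧ G.Adj w x
  · obtain ⟨v, w, u, x, hv, hw, hu, huv, hx, hwx⟩ := hc
    exact .inr (hS.isK33 hG hv hw hu huv hx hwx)
  left
  push Not at hc
  have hpair : ∀ v, ∃ a b, v ∈ S → a ≠ b ∧ externalPrivate G S v = {a, b} := by
    intro v
    by_cases hv : v ∈ S
    · obtain ⟨a, b, h⟩ := card_eq_two.1 (hS.card_two v hv)
      exact ⟨a, b, fun _ => h⟩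
    · exact ⟨v, v, fun h => absurd h hv⟩
  choose p q hpq using hpair
  have hp : ∀ v ∈ S, p v ∈ externalPrivate G S v := fun v hv => by simp [(hpq v hv).2]
  have hq : ∀ v ∈ S, q v ∈ externalPrivate G S v := fun v hv => by simp [(hpq v hv).2]
  have hmem : ∀ v ∈ S, ∀ x ∈ externalPrivate G S v, x = p v ∨ x = q v := fun v hv x hx => by
    simpa [(hpq v hv).2] using hx
  have hnb : ∀ v ∈ S, ∀ w ∈ externalPrivate G S v, ∀ x, G.Adj w x →
      x = v ∨ x ∈ externalPrivate G S v := by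
    intro v hv w hw x hwx
    by_cases hxS : x ∈ S
    · exact .inl ((mem_externalPrivate.1 hw).2.2 x hxS hwx.symm)
    · obtain ⟨u, hu, hxu⟩ := hS.cover x hxS
      by_cases huv : u = v
      · exact .inr (huv ▸ hxu)
      · exact absurd hwx (hc v w u x hv hw hu huv hxu)
  refine inFamilyT_of_pendant_pairs hG (S := S) p q
    (fun v hv => (mem_externalPrivate.1 (hp v hv)).1)
    (fun v hv => (mem_externalPrivate.1 (hq v hv)).1) (fun v hv => (hpq v hv).1)
    (fun v hv => (mem_externalPrivate.1 (hp v hv)).2.1)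
    (fun v hv => (mem_externalPrivate.1 (hq v hv)).2.1) ?_ ?_ ?_
  · intro v hv x hx
    refine (hnb v hv _ (hp v hv) x hx).imp_right fun h => ?_
    exact (hmem v hv x h).resolve_left hx.ne'
  · intro v hv x hx
    refine (hnb v hv _ (hq v hv) x hx).imp_right fun h => ?_
    exact (hmem v hv x h).resolve_right hx.ne'
  · intro x
    by_cases hx : x ∈ S
    · exact .inl hx
    · obtain ⟨v, hv, h⟩ := hS.cover x hx
      exact .inr ⟨v, hv, hmem v hv x h⟩

/-- A connected graph on `n ≥ 3` vertices has a power dominating set of at most `n / 3` vertices,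
and of less than `n / 3` vertices unless it lies in `𝒯` or is `K₃,₃`. -/
theorem exists_isPowerDominating_card_le (hG : G.Connected) (hn : 3 ≤ Fintype.card V) :
    ∃ S : Finset V, IsPowerDominating G (S : Set V) ∧ 3 * S.card ≤ Fintype.card V ∧
      (3 * S.card = Fintype.card V → InFamilyT G ∨ IsK33 G) := by
  obtain ⟨S, hS, h⟩ := exists_isDensePD_two_le hG hn
  exact ⟨S, hS.pd, three_mul_card_le h, fun hc => (hS.isTightPD h hc).inFamilyT_or_isK33 hG⟩

end ExternalPrivate

/-! ### Robust numbers of the graphs in `𝒯` and of `K₃,₃` -/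

section Extremal

variable {V : Type u} {G : SimpleGraph V}

theorem IsK33.exists_equiv (h : IsK33 G) : ∃ f : Fin 3 ⊕ Fin 3 ≃ V,
    ∀ a b, G.Adj (f a) (f b) ↔ a.isLeft ≠ b.isLeft := by
  obtain ⟨e⟩ := h
  refine ⟨e.symm.toEquiv, fun a b => ?_⟩
  have : G.Adj (e.symm a) (e.symm b) ↔ _ := e.symm.map_adj_iff
  refine this.trans ?_
  cases a <;> cases b <;> simp

theorem IsK33.card_eq [Fintype V] (h : IsK33 G) : Fintype.card V = 6 := by
  obtain ⟨f, -⟩ := h.exists_equiv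
  rw [← Fintype.card_congr f]
  rfl

/-- From a single vertex `s` nothing is forced beyond its closed neighbourhood: each vertex opposite
`s` has two unobserved neighbours. -/
theorem IsK33.two_le_card (h : IsK33 G) {D : Finset V} (hD : IsPowerDominating G (D : Set V)) :
    2 ≤ D.card := by
  obtain ⟨f, hf⟩ := h.exists_equiv
  have hne : Nonempty V := ⟨f (.inl 0)⟩
  by_contra hlt
  have h1 := hD.nonempty.card_pos
  obtain ⟨s, rfl⟩ := card_eq_one.1 (by omega : D.card = 1)
  have third : ∀ a b : Fin 3 ⊕ Fin 3, ∃ c : Fin 3 ⊕ Fin 3, c.isLeft = a.isLeft ∧ c ≠ a ∧ c ≠ b := by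
    decide
  have key : ∀ v, Observed G (({s} : Finset V) : Set V) v → v = s ∨ G.Adj s v := by
    intro v hv
    induction hv with
    | self v hv => exact .inl (by simpa using hv)
    | neighbor v w hv hw =>
      obtain rfl : v = s := by simpa using hv
      exact .inr hw
    | force v w _ hvw _ ih1 ih2 =>
      rcases ih1 with rfl | ih1
      · exact .inr hvw
      by_contra! hc
      obtain ⟨s, rfl⟩ := f.surjective s
      obtain ⟨v, rfl⟩ := f.surjective v
      obtain ⟨w, rfl⟩ := f.surjective w
      obtain ⟨c, hc1, hc2, hc3⟩ := third s w
      rw [hf] at ih1 hvw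
      have hcs : ¬ G.Adj (f s) (f c) := by rw [hf, hc1]; simp
      rcases ih2 (f c) ((hf _ _).2 (by rw [hc1]; exact ih1.symm)) (f.injective.ne hc3) with h | h
      · exact hc2 (f.injective h)
      · exact hcs h
  obtain ⟨s, rfl⟩ := f.surjective s
  obtain ⟨c, hc1, hc2, -⟩ := third s s
  rcases key (f c) (hD _) with h | h
  · exact hc2 (f.injective h)
  · rw [hf, hc1] at h
    exact h rfl

variable [Fintype V] [DecidableEq V]

theorem InFamilyT.le_robustPowerDominationNumber [Nonempty V] (h : InFamilyT G) (k : ℕ) :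
    (k + 1) * Fintype.card V ≤ 3 * robustPowerDominationNumber G k := by
  classical
  obtain ⟨W, H, A, -, ⟨e⟩⟩ := h
  have : Finite (W × Fin 3) := Finite.of_equiv V e.toEquiv
  have : Finite W := Finite.of_surjective (Prod.fst : W × Fin 3 → W) fun w => ⟨(w, 0), rfl⟩
  have := Fintype.ofFinite W
  have hcard : Fintype.card V = Fintype.card W * 3 := by
    rw [Fintype.card_congr e.toEquiv, Fintype.card_prod, Fintype.card_fin]
  suffices (k + 1) * Fintype.card W ≤ robustPowerDominationNumber G k by
    rw [hcard]; linarith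
  refine PMU.le_robustPowerDominationNumber fun S hS => ?_
  have hfib : ∀ w : W, k + 1 ≤ (S.map fun v => (e v).1).count w := by
    intro w
    by_contra hlt
    rw [Multiset.count_map] at hlt
    set R := S.filter fun v => w = (e v).1 with hR
    obtain ⟨F, hRF, hFS, hF⟩ : ∃ F, R ≤ F ∧ F ≤ S ∧ F.card = k := by
      -- Exactly `k` PMUs must fail, so `R` is padded by others; enough exist because `k ≤ |S|`.
      obtain ⟨T, hT, hTc⟩ : ∃ T ≤ S - R, T.card = k - R.card := by
        have : k - R.card ≤ (S - R).card := by
          rw [Multiset.card_sub (Multiset.filter_le _ _)]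
          exact Nat.sub_le_sub_right hS.1 _
        have hpos : 0 < ((S - R).powersetCard (k - R.card)).card := by
          rw [Multiset.card_powersetCard]
          exact Nat.choose_pos this
        obtain ⟨T, hT⟩ := Multiset.card_pos_iff_exists_mem.1 hpos
        exact ⟨T, Multiset.mem_powersetCard.1 hT⟩
      refine ⟨R + T, Multiset.le_add_right _ _, ?_, ?_⟩
      · calc R + T ≤ R + (S - R) := by gcongr
          _ = S := add_tsub_cancel_of_le (Multiset.filter_le _ _)
      · rw [Multiset.card_add]
        omega
    obtain ⟨D, hD, hpd⟩ := hS.2 F hFS hF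
    have hDw : ∀ v ∈ D, (e v).1 ≠ w := by
      intro v hv hvw
      have h1 : 0 < (S - F).count v :=
        Multiset.count_pos.2 (Multiset.mem_of_le hD hv)
      have h2 : R.count v = S.count v := Multiset.count_filter_of_pos hvw.symm
      have h3 := Multiset.count_le_of_le v hRF
      rw [Multiset.count_sub] at h1
      omega
    have hadj : ∀ x y, G.Adj x y ↔ (attachPairs H A).Adj (e x) (e y) := fun x y =>
      e.map_adj_iff.symm
    have he : ∀ i, e (e.symm (w, i)) = (w, i) := fun i => e.apply_symm_apply _
    have key := not_observed_of_twins (G := G) (S := (D : Set V))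
      (a := e.symm (w, 1)) (b := e.symm (w, 2)) (e.symm.injective.ne (by simp))
      (fun h => hDw _ h (by rw [he])) (fun h => hDw _ h (by rw [he]))
      (fun s hs h => by
        have := hDw s hs
        rw [hadj, he] at h
        simp [attachPairs] at h
        exact h.2.elim (fun h => this h.1) fun h => this h.1.symm)
      (fun s hs h => by
        have := hDw s hs
        rw [hadj, he] at h
        simp [attachPairs] at h
        exact h.2.elim (fun h => this h.1) fun h => this h.1)
      (fun x hx1 hx2 => by
        have h1 : e x ≠ (w, 1) := fun h => hx1 (e.toEquiv.eq_symm_apply.2 h)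
        have h2 : e x ≠ (w, 2) := fun h => hx2 (e.toEquiv.eq_symm_apply.2 h)
        rw [hadj, hadj, he, he]
        generalize e x = z at h1 h2
        obtain ⟨z, i⟩ := z
        fin_cases i <;> simp [attachPairs] at h1 h2 ⊢
        · exact fun h => absurd h h1
        · exact fun h => absurd h.symm h2)
      (hpd (e.symm (w, 1)))
    exact key.1 rfl
  calc (k + 1) * Fintype.card W = ∑ _w : W, (k + 1) := by simp [mul_comm]
    _ ≤ ∑ w : W, (S.map fun v => (e v).1).count w := sum_le_sum fun w _ => hfib w
    _ = (S.map fun v => (e v).1).card := by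
      rw [Multiset.sum_count_eq_card]
      simp
    _ = S.card := by simp

theorem IsK33.two_le_robustPowerDominationNumber (h : IsK33 G) :
    2 ≤ robustPowerDominationNumber G 0 := by
  obtain ⟨f, -⟩ := h.exists_equiv
  have hne : Nonempty V := ⟨f (.inl 0)⟩
  refine le_robustPowerDominationNumber fun S hS => ?_
  obtain ⟨D, hD, hpd⟩ := hS.2 0 (Multiset.zero_le S) rfl
  have := Multiset.card_le_card hD
  rw [tsub_zero] at this
  exact (h.two_le_card hpd).trans this

theorem IsK33.robustPowerDominationNumber_le (h : IsK33 G) {k : ℕ} (hk : 1 ≤ k) :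
    robustPowerDominationNumber G k ≤ 2 * k + 1 := by
  obtain ⟨f, hf⟩ := h.exists_equiv
  have hpd : ∀ i j : Fin 3, i ≠ j →
      IsPowerDominating G (({f (.inl i), f (.inl j)} : Finset V) : Set V) := by
    intro i j hij
    have hr : ∀ l, Observed G (({f (.inl i), f (.inl j)} : Finset V) : Set V) (f (.inr l)) :=
      fun l => .neighbor (f (.inl i)) _ (by simp) ((hf _ _).2 (by simp))
    have hother : ∀ i j l m : Fin 3, i ≠ j → l ≠ i → l ≠ j → m ≠ l → m = i ∨ m = j := by decide
    intro y
    obtain ⟨y, rfl⟩ := f.surjective y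
    rcases y with l | l
    · by_cases hli : l = i
      · exact .self _ (by simp [hli])
      by_cases hlj : l = j
      · exact .self _ (by simp [hlj])
      refine .force (f (.inr 0)) _ (hr 0) ((hf _ _).2 (by simp)) fun z hz hzl => ?_
      obtain ⟨z, rfl⟩ := f.surjective z
      rcases z with m | m
      · have hml : m ≠ l := by rintro rfl; exact hzl rfl
        rcases hother i j l m hij hli hlj hml with rfl | rfl
        · exact .self _ (by simp)
        · exact .self _ (by simp)
      · exact hr m
    · exact hr l
  -- Of the `2k + 1` PMUs, `k + 1` survive, and since `k ≥ 1` no vertex carries more than `k`. Two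
  -- distinct vertices of one side therefore survive, and they power dominate.
  let M : Multiset (Fin 3) :=
    Multiset.replicate k 0 + Multiset.replicate k 1 + Multiset.replicate 1 2
  have hcount : ∀ i, M.count i ≤ k := by
    intro i
    simp only [M, Multiset.count_add, Multiset.count_replicate]
    fin_cases i <;> simp [hk]
  let g : Fin 3 → V := fun i => f (.inl i)
  have hg : Function.Injective g := fun i j h => Sum.inl_injective (f.injective h)
  have hM : IsRobustPowerDominating G k (M.map g) := by
    refine ⟨by simp [M]; omega, fun F hF hFk => ?_⟩
    have hRc : (M.map g - F).card = k + 1 := by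
      rw [Multiset.card_sub hF, hFk]
      simp [M]
      omega
    have hRle : M.map g - F ≤ M.map g := tsub_le_self
    obtain ⟨x, hx⟩ := Multiset.card_pos_iff_exists_mem.1 (by omega : 0 < (M.map g - F).card)
    obtain ⟨y, hy, hyx⟩ : ∃ y ∈ M.map g - F, y ≠ x := by
      by_contra! hc
      have h1 := Multiset.eq_replicate.2 ⟨hRc, hc⟩
      have h2 := Multiset.count_le_of_le x hRle
      rw [h1, Multiset.count_replicate_self] at h2
      obtain ⟨i, -, rfl⟩ := Multiset.mem_map.1 (Multiset.mem_of_le hRle hx)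
      rw [Multiset.count_map_eq_count' _ _ hg] at h2
      have := hcount i
      omega
    refine ⟨{x, y}, ?_, ?_⟩
    · rw [Multiset.le_iff_subset (Finset.nodup _)]
      intro z hz
      have : z = x ∨ z = y := by simpa using hz
      rcases this with rfl | rfl
      exacts [hx, hy]
    · obtain ⟨i, -, rfl⟩ := Multiset.mem_map.1 (Multiset.mem_of_le hRle hx)
      obtain ⟨j, -, rfl⟩ := Multiset.mem_map.1 (Multiset.mem_of_le hRle hy)
      exact hpd i j fun h => hyx (h ▸ rfl)
  have := PMU.robustPowerDominationNumber_le hM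
  simp [M] at this
  omega

end Extremal

end PMU

theorem mainTheorem8 {V : Type u} [Fintype V] [DecidableEq V] (G : SimpleGraph V)
    (hG : G.Connected) (hn : 3 ≤ Fintype.card V) :
    (∀ k : ℕ, (PMU.robustPowerDominationNumber G k : ℚ) ≤
        ((k : ℚ) + 1) * (Fintype.card V : ℚ) / 3) ∧
    ((PMU.robustPowerDominationNumber G 0 : ℚ) = (Fintype.card V : ℚ) / 3 ↔
        PMU.InFamilyT G ∨ PMU.IsK33 G) ∧
    (∀ k : ℕ, 1 ≤ k →
      ((PMU.robustPowerDominationNumber G k : ℚ) =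
          ((k : ℚ) + 1) * (Fintype.card V : ℚ) / 3 ↔
        PMU.InFamilyT G)) := by
  have hne := hG.nonempty
  obtain ⟨S, hpd, hle, heq⟩ := PMU.exists_isPowerDominating_card_le hG hn
  have hub : ∀ k, PMU.robustPowerDominationNumber G k ≤ (k + 1) * S.card := fun k =>
    PMU.robustPowerDominationNumber_le_mul_card k hpd
  have hub' : ∀ k, 3 * PMU.robustPowerDominationNumber G k ≤ (k + 1) * Fintype.card V := by
    intro k
    have := hub k
    nlinarith
  have hcast : ∀ k, (PMU.robustPowerDominationNumber G k : ℚ) =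
      ((k : ℚ) + 1) * (Fintype.card V : ℚ) / 3 ↔
      3 * PMU.robustPowerDominationNumber G k = (k + 1) * Fintype.card V := by
    intro k
    rw [eq_div_iff (by norm_num), mul_comm]
    norm_cast
  have hfwd : ∀ k, 3 * PMU.robustPowerDominationNumber G k = (k + 1) * Fintype.card V →
      PMU.InFamilyT G ∨ PMU.IsK33 G := by
    intro k h
    have := hub k
    -- Cancelling `k + 1` in `(k + 1) n ≤ 3 (k + 1) |S|` gives `n ≤ 3|S|`.
    exact heq (le_antisymm hle (by nlinarith))
  have hT : PMU.InFamilyT G → ∀ k,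
      3 * PMU.robustPowerDominationNumber G k = (k + 1) * Fintype.card V := fun h k =>
    le_antisymm (hub' k) (h.le_robustPowerDominationNumber k)
  refine ⟨fun k => ?_, ?_, fun k hk => ?_⟩
  · rw [le_div_iff₀ (by norm_num), mul_comm]
    exact_mod_cast hub' k
  · have h0 := hcast 0
    simp only [Nat.cast_zero, zero_add, one_mul] at h0
    rw [h0]
    refine ⟨fun h => hfwd 0 (by omega), ?_⟩
    rintro (h | h)
    · have := hT h 0
      omega
    · have h1 := h.two_le_robustPowerDominationNumber
      have h2 := hub' 0
      have h3 := h.card_eq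
      omega
  · rw [hcast]
    refine ⟨fun h => (hfwd k h).resolve_right fun hK => ?_, fun h => hT h k⟩
    -- For `n = 6` equality would require `2k + 2`, but `2k + 1` PMUs suffice.
    have h1 := hK.robustPowerDominationNumber_le hk
    rw [hK.card_eq] at h
    omega
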